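/- Consider $n$ agents and a set $\mathcal I$ of $m$ indivisible heterogeneous items. A valuation $v:2^{\mathcal I}\to\mathbb R_{\ge 0}$ is monotone with $v(\emptyset)=0$; it is \emph{unit-demand} if $v(S)=\max_{j\in S}v(\{j\})$ for every nonempty $S$. An allocation gives each item to at most one agent. For a set $S$ of agents and a set $T$ of items, $SW(S,T)$ denotes the maximum of $\sum_{i\in S}v_i(A_i)$ over allocations $A$ of (some of the) items of $T$. \emph{VCG with copies} with parameter $r\in\mathbb N$ and the unit-demand rounding ($q=1$) is the following randomized mechanism. On reports $v_1,\dots,v_n$: (1) draw $\ell$ uniformly from $\{0,\dots,r\}$; (2) let $\mathcal I'=\mathcal I\times[2^\ell]$ and $v_i'(S)=v_i(\{j : \exists k,\ (j,k)\in S\})$ for $S\subseteq\mathcal I'$; (3) choose (with any fixed tie-breaking rule, depending on $\ell$ and the reports) an allocation $A'$ of $\mathcal I'$ which maximizes $\sum_i v'_i(A'_i)$ and is non-redundant, i.e. $v_i'(A_i'\setminus\{x\})<v_i'(A_i')$ for all $i$ and $x\in A_i'$, and let $p_i'=SW'(\mathcal N\setminus\{i\},\mathcal I')-SW'(\mathcal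 N\setminus\{i\},\mathcal I'\setminus A_i')$ be the VCG payments, where $\mathcal N$ is the set of agents and $SW'$ is $SW$ for the valuations $v'$; (4) independently for each item $j$ choose a uniformly random copy $(j,c_j)$; if it belongs to $A_i'$ for some agent $i$, give item $j$ to agent $i$; an agent who receives an item pays $p'_i$, and all other agents pay $0$. \textbf{Theorem.} There is a universal constant $C\ge 1$ such that for all $n$, $m$, every integer $r\ge 0$ obtained by rounding $2\log_2 n$ up or down (with $r=0$ if $n\le 1$), and every tie-breaking rule as in (3), the above mechanism, on unit-demand reports, has the following properties. It always outputs an allocation of $\mathcal I$ and non-negative payments. It is truthful in expectation: for every profile of unit-demand valuations, no agent $i$ can increase the expectation of $v_i(A_i)-p_i$ by reporting another unit-demand valuation. It is ex-post individually rational: $v_i(A_i)-p_i\ge 0$ for every agent $i$ and every outcome $(A,p)$ in the support. And for every profile of unit-demand valuations its expected residual surplus satisfies $$\mathbf E\Big[\sum_{i}\big(v_i(A_i)-p_i\big)\Big]\ \ge\ \frac{SW(\mathcal N,\mathcal I)}{C\cdot\max\{1,\log_2 n\}},$$ so for $n\ge 2$ it is a $C\log_2 n$-approximation to the optimal social welfare.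 -/

import Mathlib

noncomputable section

namespace MoneyBurning

/-! ### Valuations, allocations and social welfare -/

section Basics

variable {N J : Type*} [Fintype N] [DecidableEq N] [Fintype J]

/-- Non-negative, normalized, monotone set functions on the items. -/
structure IsValuation (v : Finset J → ℝ) : Prop where
  nonneg : ∀ S, 0 ≤ v S
  normalized : v ∅ = 0
  monotone : ∀ S T, S ⊆ T → v S ≤ v T

/-- Unit-demand valuations: the value of a nonempty set is the maximum of the values of its
items. -/
structure IsUnitDemand (v : Finset J → ℝ) : Prop extends IsValuation v where
  eq_max : ∀ (S : Finset J) (hS : S.Nonempty), v S = S.sup' hS (fun j => v {j})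

/-- The class of all unit-demand valuations over the item set `J`. -/
def unitDemand (J : Type*) : Set (Finset J → ℝ) := {v | IsUnitDemand v}

/-- `A` allocates (some of) the items of `T`, each to at most one agent. -/
def IsAllocation (T : Finset J) (A : N → Finset J) : Prop :=
  (∀ i, A i ⊆ T) ∧ ∀ i k, i ≠ k → Disjoint (A i) (A k)

open Classical in
/-- The finite set of all allocations of the items of `T` to the agents. -/
def allocations (N : Type*) {J : Type*} [Fintype N] [DecidableEq N] [Fintype J] (T : Finset J) :
    Finset (N → Finset J) :=
  Finset.univ.filter (fun A => IsAllocation T A)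

open Classical in
theorem allocations_nonempty (T : Finset J) : (allocations N T).Nonempty :=
  ⟨fun _ => ∅, Finset.mem_filter.2 ⟨Finset.mem_univ _, by simp [IsAllocation]⟩⟩

/-- Optimal social welfare `SW(S, T)` of the set of agents `S` and the set of items `T`. -/
def optWelfare (v : N → Finset J → ℝ) (S : Finset N) (T : Finset J) : ℝ :=
  (allocations N T).sup' (allocations_nonempty T) (fun A => ∑ i ∈ S, v i (A i))

/-- `A` is an allocation of (some of) the items that maximizes the social welfare. -/
def IsWelfareMaximizing (v : N → Finset J → ℝ) (A : N → Finset J) : Prop :=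
  IsAllocation Finset.univ A ∧ ∑ i, v i (A i) = optWelfare v Finset.univ Finset.univ

variable [DecidableEq J]

/-- Every allocated item strictly contributes to the value of its owner. -/
def NonRedundant (v : N → Finset J → ℝ) (A : N → Finset J) : Prop :=
  ∀ i, ∀ j ∈ A i, v i ((A i).erase j) < v i (A i)

/-- A welfare-maximizing allocation without redundant items always exists. -/
theorem exists_nonRedundant_maximizer (v : N → Finset J → ℝ) :
    ∃ A, IsWelfareMaximizing v A ∧ NonRedundant v A := by
  classical
  have hne : (Finset.univ.filter (fun A => IsWelfareMaximizing v A)).Nonempty := by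
    obtain ⟨A, hA, h⟩ := Finset.exists_mem_eq_sup' (allocations_nonempty (N := N) Finset.univ)
      (fun A => ∑ i ∈ Finset.univ, v i (A i))
    exact ⟨A, Finset.mem_filter.2 ⟨Finset.mem_univ _, (Finset.mem_filter.1 hA).2, h.symm⟩⟩
  obtain ⟨A, hA, hmin⟩ := Finset.exists_min_image _ (fun A => ∑ i, (A i).card) hne
  have hA := (Finset.mem_filter.1 hA).2
  refine ⟨A, hA, fun i j hj => ?_⟩
  by_contra! hle
  let B : N → Finset J := Function.update A i ((A i).erase j)
  have hsub : ∀ k, B k ⊆ A k := fun k => by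
    by_cases hk : k = i
    · subst hk; simp [B, Finset.erase_subset]
    · simp [B, hk]
  have hval : ∀ k, v k (A k) ≤ v k (B k) := fun k => by
    by_cases hk : k = i
    · subst hk; simpa [B] using hle
    · simp [B, hk]
  have hB : IsAllocation Finset.univ B :=
    ⟨fun _ => Finset.subset_univ _, fun k l hkl =>
      Finset.disjoint_of_subset_left (hsub k)
        (Finset.disjoint_of_subset_right (hsub l) (hA.1.2 k l hkl))⟩
  have hB' : IsWelfareMaximizing v B := by
    refine ⟨hB, le_antisymm ?_ ?_⟩
    · exact Finset.le_sup' (fun A : N → Finset J => ∑ i, v i (A i))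
        (Finset.mem_filter.2 ⟨Finset.mem_univ _, hB⟩)
    · rw [← hA.2]
      exact Finset.sum_le_sum (fun k _ => hval k)
  have h1 := hmin B (Finset.mem_filter.2 ⟨Finset.mem_univ _, hB'⟩)
  have h2 : ∑ k, (B k).card < ∑ k, (A k).card :=
    Finset.sum_lt_sum (fun k _ => Finset.card_le_card (hsub k))
      ⟨i, Finset.mem_univ _, by simpa [B] using Finset.card_erase_lt_of_mem hj⟩
  exact absurd h1 (not_le.2 h2)

/-- VCG payment of agent `i` at the allocation `A`: the externality on the other agents,
`SW(N \ {i}, J) - SW(N \ {i}, J \ A i)`. -/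
def vcgPayment (v : N → Finset J → ℝ) (A : N → Finset J) (i : N) : ℝ :=
  optWelfare v (Finset.univ.erase i) Finset.univ -
    optWelfare v (Finset.univ.erase i) (Finset.univ \ A i)

end Basics

/-! ### Randomized mechanisms -/

section Mechanisms

variable {N I : Type*} [Fintype N] [DecidableEq N] [Fintype I] [DecidableEq I]

/-- An outcome: the bundle of each agent and the payment of each agent. -/
abbrev Outcome (N I : Type*) := (N → Finset I) × (N → ℝ)

/-- A randomized mechanism maps each reported valuation profile to a distribution over outcomes. -/
abbrev Mechanism (N I : Type*) := (N → Finset I → ℝ) → PMF (Outcome N I)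

/-- Expectation of a real function under a discrete distribution (used below for distributions
with finite support only, where the sum is finite). -/
def expect {X : Type*} (p : PMF X) (f : X → ℝ) : ℝ := ∑' x, (p x).toReal * f x

/-- Quasi-linear utility of agent `i` with valuation `u`. -/
def utility (u : Finset I → ℝ) (i : N) (o : Outcome N I) : ℝ := u (o.1 i) - o.2 i

/-- Residual surplus of an outcome: welfare minus payments. -/
def residualSurplus (v : N → Finset I → ℝ) (o : Outcome N I) : ℝ :=
  ∑ i, (v i (o.1 i) - o.2 i)

/-- Every possible outcome gives each item to at most one agent, and payments are non-negative. -/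
def IsFeasible (V : Set (Finset I → ℝ)) (M : Mechanism N I) : Prop :=
  ∀ v : N → Finset I → ℝ, (∀ i, v i ∈ V) → ∀ o ∈ (M v).support,
    IsAllocation Finset.univ o.1 ∧ ∀ i, 0 ≤ o.2 i

/-- Truthfulness in expectation, for valuations and misreports from the class `V`. -/
def TruthfulInExpectation (V : Set (Finset I → ℝ)) (M : Mechanism N I) : Prop :=
  ∀ v : N → Finset I → ℝ, (∀ i, v i ∈ V) → ∀ (i : N), ∀ w ∈ V,
    expect (M (Function.update v i w)) (utility (v i) i) ≤ expect (M v) (utility (v i) i)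

/-- Ex-post individual rationality, for valuations from the class `V`. -/
def ExPostIR (V : Set (Finset I → ℝ)) (M : Mechanism N I) : Prop :=
  ∀ v : N → Finset I → ℝ, (∀ i, v i ∈ V) → ∀ o ∈ (M v).support, ∀ i,
    0 ≤ utility (v i) i o

/-- The expected residual surplus is an `α`-approximation to the optimal social welfare. -/
def ApproximatesWelfare (V : Set (Finset I → ℝ)) (M : Mechanism N I) (α : ℝ) : Prop :=
  ∀ v : N → Finset I → ℝ, (∀ i, v i ∈ V) →
    optWelfare v Finset.univ Finset.univ / α ≤ expect (M v) (residualSurplus v)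

/-! ### VCG with copies -/

/-- The items of the instance with `2 ^ ℓ` copies of each item. -/
abbrev Copies (I : Type*) (ℓ : ℕ) := I × Fin (2 ^ ℓ)

/-- The map `g`: the original items that have a copy in `S`. -/
def originals {ℓ : ℕ} (S : Finset (Copies I ℓ)) : Finset I := S.image Prod.fst

/-- The valuation profile `v'` of the instance with copies, `v' i S = v i (g S)`. -/
def copiesProfile (ℓ : ℕ) (v : N → Finset I → ℝ) : N → Finset (Copies I ℓ) → ℝ :=
  fun i S => v i (originals S)

/-- A choice, for every number `2 ^ ℓ` of copies and every reported profile, of an allocation of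
the copies. -/
abbrev CopiesRule (N I : Type*) :=
  (ℓ : ℕ) → (N → Finset I → ℝ) → N → Finset (Copies I ℓ)

/-- The rule is an implementation of the allocation step of VCG on the instances with copies: on
every profile from `V` it selects a (tie-breaking being arbitrary) welfare-maximizing allocation
without redundant items. -/
def IsVCGRule (V : Set (Finset I → ℝ)) (rule : CopiesRule N I) : Prop :=
  ∀ (ℓ : ℕ) (v : N → Finset I → ℝ), (∀ i, v i ∈ V) →
    IsWelfareMaximizing (copiesProfile ℓ v) (rule ℓ v) ∧
      NonRedundant (copiesProfile ℓ v) (rule ℓ v)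

/-- Such rules exist. -/
theorem exists_isVCGRule (V : Set (Finset I → ℝ)) : ∃ rule : CopiesRule N I, IsVCGRule V rule := by
  choose rule h using fun (ℓ : ℕ) (v : N → Finset I → ℝ) =>
    exists_nonRedundant_maximizer (copiesProfile ℓ v)
  exact ⟨rule, fun ℓ v _ => h ℓ v⟩

/-- A rounding subroutine turns an allocation of the copies together with payments into a random
outcome for the original items. -/
abbrev Rounding (N I : Type*) :=
  (ℓ : ℕ) → (N → Finset (Copies I ℓ)) → (N → ℝ) → PMF (Outcome N I)

/-- Outcome of the unit-demand rounding when copy `c j` of each item `j` is selected: item `j`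
goes to the agent who owns that copy (if any), and exactly the agents who receive an item pay. -/
def roundWith {ℓ : ℕ} (A' : N → Finset (Copies I ℓ)) (p' : N → ℝ) (c : I → Fin (2 ^ ℓ)) :
    Outcome N I :=
  let A : N → Finset I := fun i => Finset.univ.filter (fun j => (j, c j) ∈ A' i)
  (A, fun i => if (A i).Nonempty then p' i else 0)

/-- The unit-demand rounding subroutine: the copies `c j` are selected independently and uniformly,
i.e. `c` is uniform among all functions from items to copy indices. -/
def unitDemandRounding : Rounding N I :=
  fun ℓ A' p' => (PMF.uniformOfFintype (I → Fin (2 ^ ℓ))).map (roundWith A' p')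

/-- The mechanism "VCG with copies": draw `ℓ` uniformly from `{0, …, r}`, run VCG on the instance
with `2 ^ ℓ` copies of each item, and round the result with the subroutine `B`. -/
def vcgWithCopies (r : ℕ) (rule : CopiesRule N I) (B : Rounding N I) : Mechanism N I :=
  fun v => (PMF.uniformOfFintype (Fin (r + 1))).bind (fun ℓ =>
    B ℓ (rule ℓ v) (vcgPayment (copiesProfile ℓ v) (rule ℓ v)))

end Mechanisms

end MoneyBurning

end

/-! Write W_ℓ for the optimal welfare with 2^ℓ copies of each item. A unit-demand agent holds at
most one copy in a non-redundant allocation, and that copy is drawn with probability 2^(-ℓ).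
Rounding therefore scales every expected utility of VCG by 2^(-ℓ) (`expect_unitDemandRounding`), and
truthfulness is inherited from VCG for each ℓ separately.

The surplus bound rests on `sum_payment_le_copiesWelfare`: the payments at level ℓ+1 total at most
2(W_{ℓ+1} - W_ℓ). By LP duality for the assignment problem (Hall's theorem at an optimal dual
solution), optimal prices bound the VCG payments, and the same prices restricted to either half of
the copies bound W_ℓ from above.

Hence the surplus at level ℓ+1 is at least 2W_ℓ - W_{ℓ+1}. Divided by 2^(ℓ+1) and summed, this
telescopes to W_0 - W_r/2^r. Since W_r is at most n times the original optimum and 2^r ≥ 3n/2, a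
third of the optimum survives, to be averaged over r+1 levels. -/

set_option linter.unusedSectionVars false

namespace MoneyBurning

/-! ### Duality for the assignment problem -/

section Assignment

variable {α : Type*} [Fintype α] [Nonempty α]

/-- The dual objective of the assignment problem, as a function of the item prices. -/
def assignmentDual (w : α → α → ℝ) (q : α → ℝ) : ℝ :=
  ∑ b, q b + ∑ a, Finset.univ.sup' Finset.univ_nonempty (fun b => w a b - q b)

theorem continuous_assignmentDual (w : α → α → ℝ) : Continuous (assignmentDual w) := by
  unfold assignmentDual
  refine Continuous.add (by fun_prop) (continuous_finsetSum _ fun a _ => ?_)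
  exact Continuous.finset_sup'_apply _ fun b _ => by fun_prop

theorem assignmentDual_le (w : α → α → ℝ) {u q : α → ℝ} (h : ∀ a b, w a b ≤ u a + q b) :
    assignmentDual w q ≤ ∑ b, q b + ∑ a, u a := by
  unfold assignmentDual
  gcongr with a
  exact Finset.sup'_le _ _ fun b _ => by linarith [h a b]

/-- Lowering all prices by `d` raises all utilities by `d`, and both sides have equally many
members. This allows the least price to be normalized to 0. -/
theorem assignmentDual_sub_const (w : α → α → ℝ) (q : α → ℝ) (d : ℝ) :
    assignmentDual w (fun b => q b - d) = assignmentDual w q := by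
  have key : ∀ (q : α → ℝ) (d : ℝ),
      assignmentDual w (fun b => q b - d) ≤ assignmentDual w q := by
    intro q d
    refine (assignmentDual_le w (u := fun a =>
      Finset.univ.sup' Finset.univ_nonempty (fun b => w a b - q b) + d) ?_).trans ?_
    · intro a b
      have := Finset.le_sup' (fun b => w a b - q b) (Finset.mem_univ b)
      linarith
    · simp only [Finset.sum_sub_distrib, Finset.sum_add_distrib, assignmentDual]
      linarith
  refine le_antisymm (key q d) ?_
  simpa using key (fun b => q b - d) (-d)

/-- For non-negative weights the dual objective attains its minimum. -/
theorem exists_min_assignmentDual (w : α → α → ℝ) (hw : ∀ a b, 0 ≤ w a b) :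
    ∃ q : α → ℝ, ∀ q', assignmentDual w q ≤ assignmentDual w q' := by
  have hnn : ∀ (q : α → ℝ) (b₀ : α), q b₀ = 0 → ∑ b, q b ≤ assignmentDual w q := by
    intro q b₀ hb₀
    refine le_add_of_nonneg_right (Finset.sum_nonneg fun a _ => ?_)
    refine le_trans ?_ (Finset.le_sup' (fun b => w a b - q b) (Finset.mem_univ b₀))
    simpa [hb₀] using hw a b₀
  set R := assignmentDual w 0 with hR
  have hR0 : 0 ≤ R := by simpa using hnn 0 (Classical.arbitrary α) rfl
  obtain ⟨q, -, hmin⟩ := (isCompact_Icc (a := (0 : α → ℝ)) (b := fun _ => R)).exists_isMinOn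
    ⟨0, le_rfl, fun _ => hR0⟩ (continuous_assignmentDual w).continuousOn
  refine ⟨q, fun q' => ?_⟩
  -- After shifting the least price to 0, a vector outside the box has a price above `R`, so by
  -- `hnn` its objective exceeds the value `R` at zero prices.
  obtain ⟨b₀, hb₀⟩ := Finite.exists_min q'
  rw [← assignmentDual_sub_const w q' (q' b₀)]
  set p : α → ℝ := fun b => q' b - q' b₀ with hp
  have hp0 : ∀ b, 0 ≤ p b := fun b => sub_nonneg.2 (hb₀ b)
  by_cases hle : ∀ b, p b ≤ R
  · exact hmin ⟨hp0, hle⟩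
  · push Not at hle
    obtain ⟨b, hb⟩ := hle
    have h1 : assignmentDual w q ≤ R := hmin ⟨le_rfl, fun _ => hR0⟩
    have h2 := hnn p b₀ (sub_self _)
    have h3 := Finset.single_le_sum (fun b _ => hp0 b) (Finset.mem_univ b)
    linarith

/-- Strong duality for the square assignment problem. -/
theorem exists_perm_tight_dual (w : α → α → ℝ) (hw : ∀ a b, 0 ≤ w a b) :
    ∃ (σ : Equiv.Perm α) (u q : α → ℝ), (∀ a, 0 ≤ u a) ∧ (∀ b, 0 ≤ q b) ∧
      (∀ a b, w a b ≤ u a + q b) ∧ ∀ a, u a + q (σ a) = w a (σ a) := by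
  classical
  obtain ⟨q₁, hq₁⟩ := exists_min_assignmentDual w hw
  obtain ⟨b₀, hb₀⟩ := Finite.exists_min q₁
  obtain ⟨q, hq, hb₀, hq0⟩ : ∃ q : α → ℝ,
      (∀ q', assignmentDual w q ≤ assignmentDual w q') ∧ q b₀ = 0 ∧ ∀ b, 0 ≤ q b :=
    ⟨fun b => q₁ b - q₁ b₀, fun q' => (assignmentDual_sub_const w q₁ _).trans_le (hq₁ q'),
      sub_self _, fun b => sub_nonneg.2 (hb₀ b)⟩
  set u : α → ℝ := fun a => Finset.univ.sup' Finset.univ_nonempty (fun b => w a b - q b) with hu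
  have hfeas : ∀ a b, w a b ≤ u a + q b := fun a b => by
    have := Finset.le_sup' (fun b => w a b - q b) (Finset.mem_univ b)
    simp only [hu] at this ⊢
    linarith
  have hval : assignmentDual w q = ∑ b, q b + ∑ a, u a := rfl
  let t : α → Finset α := fun a => Finset.univ.filter (fun b => u a + q b = w a b)
  -- If Hall's condition failed at `S` with tight neighbourhood `G`, raising prices on `G` and
  -- lowering utilities on `S` by the least slack `ε` between `S` and the complement of `G` would
  -- stay feasible and change the objective by ε(|G| - |S|) < 0.
  have hall : ∀ S : Finset α, S.card ≤ (S.biUnion t).card := by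
    intro S
    by_contra! hlt
    set G := S.biUnion t with hG
    have hSne : S.Nonempty := Finset.card_pos.1 (by omega)
    have hGne : (Gᶜ).Nonempty := by
      rw [← Finset.card_pos, Finset.card_compl]
      have := S.card_le_univ
      omega
    have hne : (S ×ˢ Gᶜ).Nonempty := hSne.product hGne
    obtain ⟨x, hx, hmin⟩ := Finset.exists_min_image _
      (fun x : α × α => u x.1 + q x.2 - w x.1 x.2) hne
    set ε := u x.1 + q x.2 - w x.1 x.2 with hε
    have hεpos : 0 < ε := by
      rw [Finset.mem_product, Finset.mem_compl] at hx
      refine lt_of_le_of_ne (by linarith [hfeas x.1 x.2]) fun h => hx.2 ?_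
      exact Finset.mem_biUnion.2 ⟨x.1, hx.1, Finset.mem_filter.2 ⟨Finset.mem_univ _, by linarith⟩⟩
    have h1 := assignmentDual_le w (u := fun a => u a - if a ∈ S then ε else 0)
      (q := fun b => q b + if b ∈ G then ε else 0) (fun a b => by
        have h := hfeas a b
        by_cases ha : a ∈ S <;> by_cases hb : b ∈ G <;> simp only [ha, hb, if_true, if_false]
        · linarith
        · have := hmin (a, b) (Finset.mem_product.2 ⟨ha, Finset.mem_compl.2 hb⟩)
          simp only at this
          linarith
        · linarith
        · linarith)
    have h2 := hq (fun b => q b + if b ∈ G then ε else 0)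
    rw [Finset.sum_add_distrib, Finset.sum_sub_distrib, Finset.sum_ite_mem, Finset.sum_ite_mem,
      Finset.univ_inter, Finset.univ_inter, Finset.sum_const, Finset.sum_const,
      nsmul_eq_mul, nsmul_eq_mul] at h1
    have h3 : (G.card : ℝ) * ε < S.card * ε := by
      have : (G.card : ℝ) < S.card := by exact_mod_cast hlt
      gcongr
    linarith
  obtain ⟨f, hinj, hf⟩ := (Finset.all_card_le_biUnion_card_iff_exists_injective t).1 hall
  refine ⟨Equiv.ofBijective f hinj.bijective_of_finite, u, q, fun a => ?_, hq0, hfeas,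
    fun a => (Finset.mem_filter.1 (hf a)).2⟩
  -- The item `b₀` has price 0, so the utility of `a` is at least `w a b₀`.
  have := hfeas a b₀
  have := hw a b₀
  linarith

end Assignment

/-! ### Optimal welfare and VCG payments -/

section VCG

variable {N J : Type*} [Fintype N] [DecidableEq N] [Fintype J]

theorem mem_allocations {T : Finset J} {A : N → Finset J} :
    A ∈ allocations N T ↔ IsAllocation T A := by
  classical
  simp [allocations]

theorem IsAllocation.mono {T T' : Finset J} (h : T ⊆ T') {A : N → Finset J}
    (hA : IsAllocation T A) : IsAllocation T' A :=
  ⟨fun i => (hA.1 i).trans h, hA.2⟩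

theorem IsAllocation.le_optWelfare {T : Finset J} {A : N → Finset J} (hA : IsAllocation T A)
    (v : N → Finset J → ℝ) (S : Finset N) : ∑ i ∈ S, v i (A i) ≤ optWelfare v S T :=
  Finset.le_sup' (fun A : N → Finset J => ∑ i ∈ S, v i (A i)) (mem_allocations.2 hA)

theorem optWelfare_le {v : N → Finset J → ℝ} {S : Finset N} {T : Finset J} {x : ℝ}
    (h : ∀ A, IsAllocation T A → ∑ i ∈ S, v i (A i) ≤ x) : optWelfare v S T ≤ x :=
  Finset.sup'_le _ _ fun A hA => h A (mem_allocations.1 hA)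

theorem optWelfare_mono (v : N → Finset J → ℝ) (S : Finset N) {T T' : Finset J} (h : T ⊆ T') :
    optWelfare v S T ≤ optWelfare v S T' :=
  optWelfare_le fun _ hA => (hA.mono h).le_optWelfare v S

theorem optWelfare_congr {v w : N → Finset J → ℝ} {S : Finset N} (h : ∀ i ∈ S, v i = w i)
    (T : Finset J) : optWelfare v S T = optWelfare w S T := by
  unfold optWelfare
  congr 1
  funext A
  exact Finset.sum_congr rfl fun i hi => by rw [h i hi]

theorem optWelfare_empty (v : N → Finset J → ℝ) (T : Finset J) : optWelfare v ∅ T = 0 := by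
  simp [optWelfare]

theorem optWelfare_erase_le {v : N → Finset J → ℝ} (S : Finset N) (i : N)
    (h : ∀ T, 0 ≤ v i T) (T : Finset J) : optWelfare v (S.erase i) T ≤ optWelfare v S T :=
  optWelfare_le fun A hA => (Finset.sum_le_sum_of_subset_of_nonneg (Finset.erase_subset _ _)
    fun k hk hk' => by
      have : k = i := by by_contra hki; exact hk' (Finset.mem_erase.2 ⟨hki, hk⟩)
      exact this ▸ h _).trans (hA.le_optWelfare v S)

theorem optWelfare_nonneg {v : N → Finset J → ℝ} (h : ∀ i T, 0 ≤ v i T) (S : Finset N)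
    (T : Finset J) : 0 ≤ optWelfare v S T :=
  (Finset.sum_nonneg fun i _ => h i ∅).trans
    (IsAllocation.le_optWelfare (A := fun _ => ∅) (by simp [IsAllocation]) v S)

theorem optWelfare_le_map {K : Type*} [Fintype K] (e : J ↪ K) {v : N → Finset J → ℝ}
    {v' : N → Finset K → ℝ} (h : ∀ i S, v' i (S.map e) = v i S) (S : Finset N) :
    optWelfare v S Finset.univ ≤ optWelfare v' S (Finset.univ.map e) := by
  refine optWelfare_le fun A hA => ?_
  have hB : IsAllocation (Finset.univ.map e) (fun i => (A i).map e) :=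
    ⟨fun i => Finset.map_subset_map.2 (Finset.subset_univ _),
      fun i k hik => (Finset.disjoint_map e).2 (hA.2 i k hik)⟩
  simpa [h] using hB.le_optWelfare v' S

theorem IsAllocation.update {T : Finset J} [DecidableEq J] {A : N → Finset J} {i : N}
    {B : Finset J} (hA : IsAllocation T A) (hB : ∀ k, k ≠ i → Disjoint B (A k)) (hBT : B ⊆ T) :
    IsAllocation T (Function.update A i B) := by
  refine ⟨fun k => ?_, fun k l hkl => ?_⟩
  · by_cases hk : k = i
    · subst hk; simpa using hBT
    · simpa [hk] using hA.1 k
  · by_cases hk : k = i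
    · subst hk; simpa [hkl.symm] using hB l hkl.symm
    · by_cases hl : l = i
      · subst hl; simpa [hk] using (hB k hk).symm
      · simpa [hk, hl] using hA.2 k l hkl

theorem sum_erase_update (v : N → Finset J → ℝ) (A : N → Finset J) (i : N) (B : Finset J) :
    ∑ k ∈ Finset.univ.erase i, v k (Function.update A i B k) =
      ∑ k ∈ Finset.univ.erase i, v k (A k) :=
  Finset.sum_congr rfl fun k hk => by rw [Function.update_of_ne (Finset.ne_of_mem_erase hk)]

variable [DecidableEq J]

theorem vcgPayment_nonneg (v : N → Finset J → ℝ) (A : N → Finset J) (i : N) :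
    0 ≤ vcgPayment v A i :=
  sub_nonneg.2 (optWelfare_mono v _ (Finset.sdiff_subset))

theorem vcgPayment_of_eq_empty (v : N → Finset J → ℝ) {A : N → Finset J} {i : N} (h : A i = ∅) :
    vcgPayment v A i = 0 := by
  simp [vcgPayment, h]

theorem vcgPayment_of_subsingleton [Subsingleton N] (v : N → Finset J → ℝ) (A : N → Finset J)
    (i : N) : vcgPayment v A i = 0 := by
  have : (Finset.univ.erase i : Finset N) = ∅ := by
    ext k; simp [Subsingleton.elim k i]
  simp [vcgPayment, this, optWelfare_empty]

/-- At a fixed allocation the payment involves only the other agents' reports; a misreport can act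
only through the allocation. -/
theorem vcgPayment_update (v : N → Finset J → ℝ) (A : N → Finset J) (i : N) (w : Finset J → ℝ) :
    vcgPayment (Function.update v i w) A i = vcgPayment v A i := by
  have h : ∀ k ∈ (Finset.univ.erase i : Finset N), Function.update v i w k = v k := fun k hk =>
    Function.update_of_ne (Finset.ne_of_mem_erase hk) _ _
  simp only [vcgPayment, optWelfare_congr h]

/-- Emptying the bundle of `i` leaves the other bundles intact and disjoint from `A i`. -/
theorem IsAllocation.sum_erase_le {A : N → Finset J} (hA : IsAllocation Finset.univ A)
    (v : N → Finset J → ℝ) (i : N) :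
    ∑ k ∈ Finset.univ.erase i, v k (A k) ≤
      optWelfare v (Finset.univ.erase i) (Finset.univ \ A i) := by
  have hB : IsAllocation (Finset.univ \ A i) (Function.update A i ∅) := by
    refine ⟨fun k => ?_, (hA.update (by simp) (by simp)).2⟩
    by_cases hk : k = i
    · subst hk; simp
    · simp only [Function.update_of_ne hk]
      exact Finset.subset_sdiff.2 ⟨Finset.subset_univ _, hA.2 k i hk⟩
  rw [← sum_erase_update v A i ∅]
  exact hB.le_optWelfare v _

theorem IsWelfareMaximizing.payment_le {v : N → Finset J → ℝ} {A : N → Finset J}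
    (hA : IsWelfareMaximizing v A) {i : N} (h : ∀ T, 0 ≤ v i T) :
    vcgPayment v A i ≤ v i (A i) := by
  have h1 := hA.1.sum_erase_le v i
  have h2 := hA.2
  have h3 := optWelfare_erase_le Finset.univ i h Finset.univ
  rw [← Finset.add_sum_erase _ _ (Finset.mem_univ i)] at h2
  unfold vcgPayment
  linarith

/-- Truthfulness of VCG: the bundle and payment obtained from a welfare-maximizing allocation are
at least as good for agent `i` as those obtained from any other allocation. -/
theorem IsWelfareMaximizing.truthful {v : N → Finset J → ℝ} {A B : N → Finset J}
    (hA : IsWelfareMaximizing v A) (i : N) :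
    v i (B i) - vcgPayment v B i ≤ v i (A i) - vcgPayment v A i := by
  have h1 := hA.1.sum_erase_le v i
  have h2 := hA.2
  rw [← Finset.add_sum_erase _ _ (Finset.mem_univ i)] at h2
  -- Any allocation of the items outside `B i` can be completed by handing `B i` to agent `i`.
  -- Nothing about the other bundles of `B` matters.
  have h3 : optWelfare v (Finset.univ.erase i) (Finset.univ \ B i) ≤
      optWelfare v Finset.univ Finset.univ - v i (B i) := by
    refine optWelfare_le fun D hD => ?_
    have hE : IsAllocation Finset.univ (Function.update D i (B i)) :=
      (hD.mono (Finset.subset_univ _)).update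
        (fun k _ => (Finset.subset_sdiff.1 (hD.1 k)).2.symm) (Finset.subset_univ _)
    have h4 := hE.le_optWelfare v Finset.univ
    rw [← Finset.add_sum_erase _ _ (Finset.mem_univ i), sum_erase_update,
      Function.update_self] at h4
    linarith
  unfold vcgPayment
  linarith

end VCG

/-! ### Supporting prices for unit-demand valuations -/

section Prices

variable {N J : Type*} [Fintype N] [DecidableEq N] [Fintype J]

/-- Utilities `u` and prices `q` that are feasible for the dual of the assignment problem. -/
structure IsDualFeasible (v : N → Finset J → ℝ) (u : N → ℝ) (q : J → ℝ) : Prop where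
  utility_nonneg : ∀ i, 0 ≤ u i
  price_nonneg : ∀ j, 0 ≤ q j
  value_le : ∀ i j, v i {j} ≤ u i + q j

theorem IsUnitDemand.exists_eq_singleton {f : Finset J → ℝ} (hf : IsUnitDemand f) {S : Finset J}
    (hS : S.Nonempty) : ∃ j ∈ S, f S = f {j} := by
  obtain ⟨j, hj, h⟩ := Finset.exists_mem_eq_sup' hS (fun j => f {j})
  exact ⟨j, hj, (hf.eq_max S hS).trans h⟩

theorem IsDualFeasible.bundle_le {v : N → Finset J → ℝ} {u : N → ℝ} {q : J → ℝ}
    (h : IsDualFeasible v u q) {i : N} (hv : IsUnitDemand (v i)) (S : Finset J) :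
    v i S ≤ u i + ∑ j ∈ S, q j := by
  rcases S.eq_empty_or_nonempty with rfl | hS
  · simpa [hv.normalized] using h.utility_nonneg i
  · obtain ⟨j, hj, hj'⟩ := hv.exists_eq_singleton hS
    have := h.value_le i j
    have := Finset.single_le_sum (fun k _ => h.price_nonneg k) hj
    linarith

theorem IsAllocation.sum_sum_le {A : N → Finset J} {T : Finset J} (hA : IsAllocation T A)
    {q : J → ℝ} (hq : ∀ j, 0 ≤ q j) (S : Finset N) :
    ∑ i ∈ S, ∑ j ∈ A i, q j ≤ ∑ j ∈ T, q j := by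
  classical
  rw [← Finset.sum_biUnion fun i _ k _ hik => hA.2 i k hik]
  exact Finset.sum_le_sum_of_subset_of_nonneg (Finset.biUnion_subset.2 fun i _ => hA.1 i)
    fun j _ _ => hq j

/-- Weak duality for all submarkets at once: a single dual pair serves when an agent is removed and
when only half of the copies are kept. -/
theorem IsDualFeasible.optWelfare_le {v : N → Finset J → ℝ} {u : N → ℝ} {q : J → ℝ}
    (h : IsDualFeasible v u q) (hv : ∀ i, IsUnitDemand (v i)) (S : Finset N) (T : Finset J) :
    optWelfare v S T ≤ ∑ i ∈ S, u i + ∑ j ∈ T, q j :=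
  MoneyBurning.optWelfare_le fun A hA => by
    have h1 := Finset.sum_le_sum (s := S) fun i _ => h.bundle_le (hv i) (A i)
    rw [Finset.sum_add_distrib] at h1
    have h2 := hA.sum_sum_le h.price_nonneg S
    linarith

/-- Strong duality: the optimal welfare is attained by a dual feasible pair. -/
theorem exists_isDualFeasible {v : N → Finset J → ℝ} (hv : ∀ i, IsUnitDemand (v i)) :
    ∃ u q, IsDualFeasible v u q ∧
      ∑ i, u i + ∑ j, q j ≤ optWelfare v Finset.univ Finset.univ := by
  classical
  rcases isEmpty_or_nonempty (N ⊕ J) with hE | hE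
  · obtain ⟨hN, hJ⟩ := isEmpty_sum.1 hE
    exact ⟨0, 0, ⟨fun _ => le_rfl, fun _ => le_rfl, fun i => isEmptyElim i⟩,
      by simpa using optWelfare_nonneg (fun i => (hv i).nonneg) _ _⟩
  -- Padding to a square problem: agents and items appear on both sides, and every pair other than
  -- agent-to-item has weight 0. An agent matched to an agent stays unassigned.
  let w : N ⊕ J → N ⊕ J → ℝ := fun a b =>
    match a, b with
    | Sum.inl i, Sum.inr j => v i {j}
    | _, _ => 0
  have hw : ∀ a b, 0 ≤ w a b := by
    rintro (i | j) (k | l)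
    · exact le_rfl
    · exact (hv i).nonneg _
    · exact le_rfl
    · exact le_rfl
  obtain ⟨σ, u, q, hu, hq, hf, ht⟩ := exists_perm_tight_dual w hw
  refine ⟨fun i => u (Sum.inl i), fun j => q (Sum.inr j),
    ⟨fun i => hu _, fun j => hq _, fun i j => hf (Sum.inl i) (Sum.inr j)⟩, ?_⟩
  let A : N → Finset J := fun i => Finset.univ.filter (fun j => σ (Sum.inl i) = Sum.inr j)
  have hA : IsAllocation Finset.univ A := by
    refine ⟨fun _ => Finset.subset_univ _, fun i k hik => Finset.disjoint_left.2 fun j hi hk => ?_⟩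
    simp only [A, Finset.mem_filter, Finset.mem_univ, true_and] at hi hk
    exact hik (Sum.inl_injective (σ.injective (hi.trans hk.symm)))
  have hval : ∀ i, w (Sum.inl i) (σ (Sum.inl i)) = v i (A i) := by
    intro i
    rcases h : σ (Sum.inl i) with k | j
    · simp [w, A, h, (hv i).normalized]
    · have : A i = {j} := by ext l; simp [A, h, eq_comm]
      simp [w, this]
  have hsum : ∑ a, u a + ∑ b, q b = ∑ a, w a (σ a) := by
    rw [← Equiv.sum_comp σ q, ← Finset.sum_add_distrib]
    exact Finset.sum_congr rfl fun a _ => ht a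
  have hz : ∀ j, w (Sum.inr j) (σ (Sum.inr j)) = 0 := fun j => rfl
  rw [Fintype.sum_sum_type, Fintype.sum_sum_type, Fintype.sum_sum_type] at hsum
  simp only [hval, hz, Finset.sum_const_zero, add_zero] at hsum
  have h1 := hA.le_optWelfare v Finset.univ
  have h2 : 0 ≤ ∑ j, u (Sum.inr j) := Finset.sum_nonneg fun j _ => hu _
  have h3 : 0 ≤ ∑ i, q (Sum.inl i) := Finset.sum_nonneg fun j _ => hq _
  linarith

variable [DecidableEq J]

/-- The total VCG payment is at most the total price of the items for any optimal dual prices. -/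
theorem IsDualFeasible.sum_payment_le {v : N → Finset J → ℝ} {u : N → ℝ} {q : J → ℝ}
    (h : IsDualFeasible v u q) (hv : ∀ i, IsUnitDemand (v i))
    (hopt : ∑ i, u i + ∑ j, q j ≤ optWelfare v Finset.univ Finset.univ)
    {A : N → Finset J} (hA : IsWelfareMaximizing v A) :
    ∑ i, vcgPayment v A i ≤ ∑ j, q j := by
  refine (Finset.sum_le_sum fun i _ => ?_).trans (hA.1.sum_sum_le h.price_nonneg Finset.univ)
  -- The payment of `i` is at most the price of its own bundle: duality bounds the others' optimum
  -- without `i`, and optimality of `A` bounds from below what they get in `A`.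
  have h1 := h.optWelfare_le hv (Finset.univ.erase i) Finset.univ
  have h2 := hA.1.sum_erase_le v i
  have h3 := hA.2
  have h4 := h.bundle_le (hv i) (A i)
  rw [← Finset.add_sum_erase _ _ (Finset.mem_univ i)] at h3 hopt
  unfold vcgPayment
  linarith

end Prices

/-! ### Expectations under finitely supported distributions -/

section Expect

variable {X : Type*}

theorem expect_pure (a : X) (f : X → ℝ) : expect (PMF.pure a) f = f a := by
  unfold expect
  rw [tsum_eq_single a fun b hb => by simp [PMF.pure_apply_of_ne a b hb]]
  simp

theorem expect_bind {ι : Type*} [Fintype ι] (p : PMF ι) (g : ι → PMF X) (f : X → ℝ)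
    (hs : ∀ i, (g i).support.Finite) :
    expect (p.bind g) f = ∑ i, (p i).toReal * expect (g i) f := by
  have hsum : ∀ i, Summable fun x => (p i).toReal * ((g i x).toReal * f x) := fun i =>
    Summable.mul_left _ (summable_of_hasFiniteSupport ((hs i).subset fun x hx => by
      rw [PMF.mem_support_iff]
      intro h0
      simp [h0] at hx))
  unfold expect
  simp only [← tsum_mul_left]
  rw [← Summable.tsum_finsetSum fun i _ => hsum i]
  refine tsum_congr fun x => ?_
  rw [PMF.bind_apply, tsum_fintype, ENNReal.toReal_sum fun i _ =>
    ENNReal.mul_ne_top (p.apply_ne_top i) ((g i).apply_ne_top x), Finset.sum_mul]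
  exact Finset.sum_congr rfl fun i _ => by rw [ENNReal.toReal_mul, mul_assoc]

theorem expect_map_uniform {ι : Type*} [Fintype ι] [Nonempty ι] (h : ι → X) (f : X → ℝ) :
    expect ((PMF.uniformOfFintype ι).map h) f = (∑ i, f (h i)) / Fintype.card ι := by
  rw [← PMF.bind_pure_comp, expect_bind _ _ _ fun i => by simp [PMF.support_pure]]
  simp [expect_pure, PMF.uniformOfFintype_apply, ← Finset.mul_sum, div_eq_inv_mul]

theorem expect_bind_uniform {ι : Type*} [Fintype ι] [Nonempty ι] (g : ι → PMF X) (f : X → ℝ)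
    (hs : ∀ i, (g i).support.Finite) :
    expect ((PMF.uniformOfFintype ι).bind g) f = (∑ i, expect (g i) f) / Fintype.card ι := by
  rw [expect_bind _ _ _ hs]
  simp [PMF.uniformOfFintype_apply, ← Finset.mul_sum, div_eq_inv_mul]

end Expect

/-! ### The instances with copies -/

section Copies

variable {N I : Type*} [Fintype N] [DecidableEq N] [Fintype I] [DecidableEq I]

theorem originals_singleton {ℓ : ℕ} (x : Copies I ℓ) : originals {x} = {x.1} := by
  simp [originals]

theorem IsUnitDemand.comp_originals {f : Finset I → ℝ} (hf : IsUnitDemand f) (ℓ : ℕ) :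
    IsUnitDemand (fun S : Finset (Copies I ℓ) => f (originals S)) where
  nonneg S := hf.nonneg _
  normalized := by simpa [originals] using hf.normalized
  monotone S T h := hf.monotone _ _ (Finset.image_subset_image h)
  eq_max S hS := by
    simp only [originals_singleton]
    exact (hf.eq_max _ (hS.image Prod.fst)).trans (Finset.sup'_image _ _)

/-- A unit-demand agent holds at most one item of a non-redundant allocation. -/
theorem IsUnitDemand.eq_empty_or_singleton {J : Type*} [Fintype J] [DecidableEq J]
    {f : Finset J → ℝ}
    (hf : IsUnitDemand f) {S : Finset J} (hS : ∀ j ∈ S, f (S.erase j) < f S) :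
    S = ∅ ∨ ∃ j, S = {j} := by
  refine S.eq_empty_or_nonempty.imp_right fun hne => ?_
  obtain ⟨j, hj, hval⟩ := hf.exists_eq_singleton hne
  refine ⟨j, Finset.eq_singleton_iff_unique_mem.2 ⟨hj, fun k hk => ?_⟩⟩
  by_contra hkj
  have h1 := hS k hk
  have h2 := hf.monotone {j} (S.erase k)
    (Finset.singleton_subset_iff.2 (Finset.mem_erase.2 ⟨Ne.symm hkj, hj⟩))
  linarith

/-- The optimal welfare of the instance with `2 ^ ℓ` copies. -/
noncomputable def copiesWelfare (ℓ : ℕ) (v : N → Finset I → ℝ) : ℝ :=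
  optWelfare (copiesProfile ℓ v) Finset.univ Finset.univ

theorem optWelfare_le_copiesWelfare_zero (v : N → Finset I → ℝ) :
    optWelfare v Finset.univ Finset.univ ≤ copiesWelfare 0 v := by
  let e : I ↪ Copies I 0 := ⟨fun j => (j, 0), fun a b h => (Prod.mk.inj h).1⟩
  refine (optWelfare_le_map e (fun i S => ?_) _).trans
    (optWelfare_mono _ _ (Finset.subset_univ _))
  simp only [copiesProfile, originals, Finset.map_eq_image, Finset.image_image]
  exact congrArg (v i) Finset.image_id

theorem copiesWelfare_le_optWelfare_map {ℓ k : ℕ} (e : Fin (2 ^ ℓ) ↪ Fin (2 ^ k))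
    (v : N → Finset I → ℝ) :
    copiesWelfare ℓ v ≤ optWelfare (copiesProfile k v) Finset.univ
      (Finset.univ.map ((Function.Embedding.refl I).prodMap e)) := by
  refine optWelfare_le_map _ (fun i S => ?_) _
  simp only [copiesProfile, originals, Finset.map_eq_image, Finset.image_image]
  rfl

/-- The welfare with any number of copies is at most `|N|` times the welfare without copies. -/
theorem copiesWelfare_le_card_mul {v : N → Finset I → ℝ} (hv : ∀ i, IsUnitDemand (v i)) (ℓ : ℕ) :
    copiesWelfare ℓ v ≤ Fintype.card N * optWelfare v Finset.univ Finset.univ := by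
  refine optWelfare_le fun A _ => ?_
  rw [← nsmul_eq_mul, ← Finset.card_univ]
  refine Finset.sum_le_card_nsmul _ _ _ fun i _ => ?_
  -- Giving everything to agent `i` shows that no single agent's value exceeds the optimum.
  have hB : IsAllocation Finset.univ (Function.update (fun _ : N => (∅ : Finset I)) i
      Finset.univ) :=
    IsAllocation.update (by simp [IsAllocation]) (by simp) le_rfl
  refine le_trans ?_ (hB.le_optWelfare v Finset.univ)
  refine le_trans ?_ (Finset.single_le_sum (fun k _ => (hv k).nonneg _) (Finset.mem_univ i))
  rw [Function.update_self]
  exact (hv i).monotone _ _ (Finset.subset_univ _)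

/-- Total VCG payments are at most twice the welfare gained by doubling the number of copies. -/
theorem sum_payment_le_copiesWelfare {v : N → Finset I → ℝ} (hv : ∀ i, IsUnitDemand (v i)) {ℓ : ℕ}
    {A : N → Finset (Copies I (ℓ + 1))} (hA : IsWelfareMaximizing (copiesProfile (ℓ + 1) v) A) :
    ∑ i, vcgPayment (copiesProfile (ℓ + 1) v) A i ≤
      2 * (copiesWelfare (ℓ + 1) v - copiesWelfare ℓ v) := by
  have hv' : ∀ i, IsUnitDemand (copiesProfile (ℓ + 1) v i) := fun i => (hv i).comp_originals _
  obtain ⟨u, q, hd, hopt⟩ := exists_isDualFeasible hv'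
  have hpay := hd.sum_payment_le hv' hopt hA
  have hpow : 2 ^ (ℓ + 1) = 2 ^ ℓ + 2 ^ ℓ := by ring
  -- `e₀` and `e₁` embed the smaller instance as the lower and upper half of the copies. Adding the
  -- two dual bounds gives 2W_ℓ ≤ 2∑u + ∑q, while ∑u + ∑q ≤ W_{ℓ+1}; hence ∑q ≤ 2(W_{ℓ+1} - W_ℓ).
  let e₀ : Fin (2 ^ ℓ) ↪ Fin (2 ^ (ℓ + 1)) :=
    ⟨fun k => ⟨k, by omega⟩, fun a b h => by simpa [Fin.ext_iff] using h⟩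
  let e₁ : Fin (2 ^ ℓ) ↪ Fin (2 ^ (ℓ + 1)) :=
    ⟨fun k => ⟨2 ^ ℓ + k, by omega⟩, fun a b h => by simpa [Fin.ext_iff] using h⟩
  have h₀ := (copiesWelfare_le_optWelfare_map e₀ v).trans (hd.optWelfare_le hv' _ _)
  have h₁ := (copiesWelfare_le_optWelfare_map e₁ v).trans (hd.optWelfare_le hv' _ _)
  have hdisj : Disjoint
      ((Finset.univ : Finset (Copies I ℓ)).map ((Function.Embedding.refl I).prodMap e₀))
      ((Finset.univ : Finset (Copies I ℓ)).map ((Function.Embedding.refl I).prodMap e₁)) := by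
    rw [Finset.disjoint_left]
    rintro x hx hx'
    obtain ⟨⟨a, k⟩, -, rfl⟩ := Finset.mem_map.1 hx
    obtain ⟨⟨b, l⟩, -, h⟩ := Finset.mem_map.1 hx'
    have : 2 ^ ℓ + (l : ℕ) = k := congrArg (fun x : Copies I (ℓ + 1) => (x.2 : ℕ)) h
    omega
  have hq := Finset.sum_le_sum_of_subset_of_nonneg (Finset.subset_univ (Finset.disjUnion _ _ hdisj))
    fun x _ _ => hd.price_nonneg x
  rw [Finset.sum_disjUnion] at hq
  have : copiesWelfare (ℓ + 1) v =
    optWelfare (copiesProfile (ℓ + 1) v) Finset.univ Finset.univ := rfl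
  linarith

/-! ### The unit-demand rounding -/

theorem roundWith_fst {ℓ : ℕ} (A : N → Finset (Copies I ℓ)) (p : N → ℝ) (c : I → Fin (2 ^ ℓ))
    (i : N) : (roundWith A p c).1 i = Finset.univ.filter (fun j => (j, c j) ∈ A i) := rfl

theorem roundWith_snd {ℓ : ℕ} (A : N → Finset (Copies I ℓ)) (p : N → ℝ) (c : I → Fin (2 ^ ℓ))
    (i : N) : (roundWith A p c).2 i = if ((roundWith A p c).1 i).Nonempty then p i else 0 := rfl

theorem IsAllocation.roundWith {ℓ : ℕ} {A : N → Finset (Copies I ℓ)}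
    (hA : IsAllocation Finset.univ A) (p : N → ℝ) (c : I → Fin (2 ^ ℓ)) :
    IsAllocation Finset.univ (MoneyBurning.roundWith A p c).1 := by
  refine ⟨fun _ => Finset.subset_univ _, fun i k hik => Finset.disjoint_left.2 fun j hi hk => ?_⟩
  rw [roundWith_fst, Finset.mem_filter] at hi hk
  exact Finset.disjoint_left.1 (hA.2 i k hik) hi.2 hk.2

theorem utility_roundWith_of_empty {ℓ : ℕ} {A : N → Finset (Copies I ℓ)} {i : N} (hA : A i = ∅)
    (p : N → ℝ) (c : I → Fin (2 ^ ℓ)) {u : Finset I → ℝ} (hu : u ∅ = 0) :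
    utility u i (roundWith A p c) = 0 := by
  simp [utility, roundWith_snd, roundWith_fst, hA, hu]

theorem utility_roundWith_of_singleton {ℓ : ℕ} {A : N → Finset (Copies I ℓ)} {i : N}
    {x : Copies I ℓ} (hA : A i = {x}) (p : N → ℝ) (c : I → Fin (2 ^ ℓ)) {u : Finset I → ℝ}
    (hu : u ∅ = 0) :
    utility u i (roundWith A p c) = if c x.1 = x.2 then u (originals (A i)) - p i else 0 := by
  have h : (roundWith A p c).1 i = if c x.1 = x.2 then {x.1} else ∅ := by
    rw [roundWith_fst, hA]
    split_ifs with hc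
    · ext j
      simp only [Finset.mem_filter, Finset.mem_univ, true_and, Finset.mem_singleton, Prod.ext_iff]
      exact ⟨And.left, fun hj => ⟨hj, hj ▸ hc⟩⟩
    · ext j
      simp only [Finset.mem_filter, Finset.mem_univ, true_and, Finset.mem_singleton, Prod.ext_iff,
        Finset.notMem_empty, iff_false, not_and]
      rintro rfl
      exact hc
  rw [utility, roundWith_snd, h, hA, originals_singleton]
  split_ifs <;> simp_all

/-- Swapping `k` and `k'` in the codomain matches the functions taking either value at `j`, so all
these fibres have equal size. This is the uniformity of a single coordinate. -/
theorem sum_ite_apply_eq {K : Type*} [Fintype K] [DecidableEq K] (j : I) (k : K) (y : ℝ) :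
    (∑ c : I → K, if c j = k then y else 0) * Fintype.card K = Fintype.card (I → K) * y := by
  have h : ∀ k' : K, (∑ c : I → K, if c j = k' then y else 0) =
      ∑ c : I → K, if c j = k then y else 0 := fun k' =>
    Fintype.sum_equiv (Equiv.arrowCongr (Equiv.refl I) (Equiv.swap k k')) _ _ fun c => by
      have : Equiv.swap k k' (c j) = k ↔ c j = k' := by
        rw [Equiv.swap_apply_eq_iff, Equiv.swap_apply_left]
      simp [Equiv.arrowCongr, this]
  have h2 : ∑ k' : K, (∑ c : I → K, if c j = k' then y else 0) = Fintype.card (I → K) * y := by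
    rw [Finset.sum_comm]
    simp
  rw [← h2, Finset.sum_congr rfl fun k' _ => h k']
  simp [mul_comm]

/-- With bundles of at most one copy, the rounding scales all expected utilities by `1 / 2 ^ ℓ`. -/
theorem expect_unitDemandRounding {ℓ : ℕ} {A : N → Finset (Copies I ℓ)} {p : N → ℝ} {i : N}
    (hA : A i = ∅ ∨ ∃ x, A i = {x}) (hp : A i = ∅ → p i = 0) {u : Finset I → ℝ} (hu : u ∅ = 0) :
    expect (unitDemandRounding ℓ A p) (utility u i) = (u (originals (A i)) - p i) / 2 ^ ℓ := by
  rw [unitDemandRounding, expect_map_uniform]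
  rcases hA with h | ⟨x, h⟩
  · simp [utility_roundWith_of_empty h, hu, hp h, h, originals]
  · simp only [utility_roundWith_of_singleton h _ _ hu]
    have h1 := sum_ite_apply_eq x.1 x.2 (u (originals (A i)) - p i)
    have h2 : (Fintype.card (I → Fin (2 ^ ℓ)) : ℝ) ≠ 0 := by simp
    rw [div_eq_div_iff h2 (by positivity)]
    simpa [mul_comm] using h1

theorem finite_support_unitDemandRounding (ℓ : ℕ) (A : N → Finset (Copies I ℓ)) (p : N → ℝ) :
    (unitDemandRounding ℓ A p).support.Finite := by
  rw [unitDemandRounding, PMF.support_map]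
  exact (Set.toFinite _).image _

/-! ### VCG with copies -/

variable {rule : CopiesRule N I} {r : ℕ}

/-- The VCG payment of agent `i` in the instance with `2 ^ ℓ` copies. -/
noncomputable def rulePayment (rule : CopiesRule N I) (ℓ : ℕ) (v : N → Finset I → ℝ) (i : N) : ℝ :=
  vcgPayment (copiesProfile ℓ v) (rule ℓ v) i

theorem IsVCGRule.eq_empty_or_singleton (hrule : IsVCGRule (unitDemand I) rule)
    {v : N → Finset I → ℝ} (hv : ∀ i, v i ∈ unitDemand I) (ℓ : ℕ) (i : N) :
    rule ℓ v i = ∅ ∨ ∃ x, rule ℓ v i = {x} :=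
  IsUnitDemand.eq_empty_or_singleton ((hv i).comp_originals ℓ) ((hrule ℓ v hv).2 i)

theorem mem_support_vcgWithCopies {v : N → Finset I → ℝ} {o : Outcome N I}
    (ho : o ∈ (vcgWithCopies r rule unitDemandRounding v).support) :
    ∃ (ℓ : ℕ) (c : I → Fin (2 ^ ℓ)), o = roundWith (rule ℓ v) (rulePayment rule ℓ v) c := by
  rw [vcgWithCopies, PMF.mem_support_bind_iff] at ho
  obtain ⟨ℓ, -, ho⟩ := ho
  rw [unitDemandRounding, PMF.mem_support_map_iff] at ho
  obtain ⟨c, -, rfl⟩ := ho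
  exact ⟨ℓ, c, rfl⟩

theorem expect_vcgWithCopies (v : N → Finset I → ℝ) (f : Outcome N I → ℝ) :
    expect (vcgWithCopies r rule unitDemandRounding v) f =
      (∑ ℓ ∈ Finset.range (r + 1),
        expect (unitDemandRounding ℓ (rule ℓ v) (rulePayment rule ℓ v)) f) / (r + 1) := by
  rw [vcgWithCopies, expect_bind_uniform _ _ fun ℓ => finite_support_unitDemandRounding _ _ _,
    Finset.sum_range]
  simp only [Fintype.card_fin, Nat.cast_add, Nat.cast_one]
  rfl

/-- The valuation `u` is independent of the reports `v`, so the outcome of a misreport can be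
evaluated with the true valuation. -/
theorem IsVCGRule.expect_utility (hrule : IsVCGRule (unitDemand I) rule)
    {v : N → Finset I → ℝ} (hv : ∀ i, v i ∈ unitDemand I) (ℓ : ℕ) (i : N) {u : Finset I → ℝ}
    (hu : u ∅ = 0) :
    expect (unitDemandRounding ℓ (rule ℓ v) (rulePayment rule ℓ v)) (utility u i) =
      (u (originals (rule ℓ v i)) - rulePayment rule ℓ v i) / 2 ^ ℓ :=
  expect_unitDemandRounding (hrule.eq_empty_or_singleton hv ℓ i)
    (fun h => vcgPayment_of_eq_empty _ h) hu

theorem IsVCGRule.isFeasible (hrule : IsVCGRule (unitDemand I) rule) :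
    IsFeasible (unitDemand I) (vcgWithCopies r rule unitDemandRounding) := by
  intro v hv o ho
  obtain ⟨ℓ, c, rfl⟩ := mem_support_vcgWithCopies ho
  refine ⟨(hrule ℓ v hv).1.1.roundWith _ _, fun i => ?_⟩
  rw [roundWith_snd]
  split_ifs
  · exact vcgPayment_nonneg _ _ _
  · exact le_rfl

theorem IsVCGRule.exPostIR (hrule : IsVCGRule (unitDemand I) rule) :
    ExPostIR (unitDemand I) (vcgWithCopies r rule unitDemandRounding) := by
  intro v hv o ho i
  obtain ⟨ℓ, c, rfl⟩ := mem_support_vcgWithCopies ho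
  rcases hrule.eq_empty_or_singleton hv ℓ i with h | ⟨x, h⟩
  · rw [utility_roundWith_of_empty h _ _ (hv i).normalized]
  · rw [utility_roundWith_of_singleton h _ _ (hv i).normalized]
    split_ifs
    · exact sub_nonneg.2 ((hrule ℓ v hv).1.payment_le fun T => (hv i).nonneg _)
    · exact le_rfl

theorem copiesProfile_update (ℓ : ℕ) (v : N → Finset I → ℝ) (i : N) (w : Finset I → ℝ) :
    copiesProfile ℓ (Function.update v i w) =
      Function.update (copiesProfile ℓ v) i (fun S => w (originals S)) := by
  funext k S
  by_cases hk : k = i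
  · subst hk; simp [copiesProfile]
  · simp [copiesProfile, hk]

theorem IsVCGRule.truthfulInExpectation (hrule : IsVCGRule (unitDemand I) rule) :
    TruthfulInExpectation (unitDemand I) (vcgWithCopies r rule unitDemandRounding) := by
  intro v hv i w hw
  have hv' : ∀ k, Function.update v i w k ∈ unitDemand I := fun k => by
    by_cases hk : k = i
    · subst hk; simpa using hw
    · simpa [hk] using hv k
  rw [expect_vcgWithCopies, expect_vcgWithCopies]
  refine div_le_div_of_nonneg_right (Finset.sum_le_sum fun ℓ _ => ?_) (by positivity)
  rw [hrule.expect_utility hv' ℓ i (hv i).normalized, hrule.expect_utility hv ℓ i (hv i).normalized]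
  refine div_le_div_of_nonneg_right ?_ (by positivity)
  -- The deviator's payment is now computed in the true profile, so the misreport is just another
  -- allocation to compare with.
  rw [rulePayment, copiesProfile_update, vcgPayment_update]
  exact (hrule ℓ v hv).1.truthful i

/-- The residual surplus of VCG in the instance with `2 ^ ℓ` copies. -/
noncomputable def ruleSurplus (rule : CopiesRule N I) (ℓ : ℕ) (v : N → Finset I → ℝ) : ℝ :=
  ∑ i, (copiesProfile ℓ v i (rule ℓ v i) - rulePayment rule ℓ v i)

theorem IsVCGRule.expect_residualSurplus (hrule : IsVCGRule (unitDemand I) rule)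
    {v : N → Finset I → ℝ} (hv : ∀ i, v i ∈ unitDemand I) :
    expect (vcgWithCopies r rule unitDemandRounding v) (residualSurplus v) =
      (∑ ℓ ∈ Finset.range (r + 1), ruleSurplus rule ℓ v / 2 ^ ℓ) / (r + 1) := by
  rw [expect_vcgWithCopies]
  congr 1
  refine Finset.sum_congr rfl fun ℓ _ => ?_
  rw [ruleSurplus, Finset.sum_div]
  refine Eq.trans ?_ (Finset.sum_congr rfl fun i _ =>
    hrule.expect_utility hv ℓ i (hv i).normalized)
  simp only [unitDemandRounding, expect_map_uniform]
  rw [← Finset.sum_div, Finset.sum_comm]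
  rfl

theorem IsVCGRule.ruleSurplus_eq (hrule : IsVCGRule (unitDemand I) rule)
    {v : N → Finset I → ℝ} (hv : ∀ i, v i ∈ unitDemand I) (ℓ : ℕ) :
    ruleSurplus rule ℓ v = copiesWelfare ℓ v - ∑ i, rulePayment rule ℓ v i := by
  rw [ruleSurplus, Finset.sum_sub_distrib, (hrule ℓ v hv).1.2]
  rfl

theorem IsVCGRule.ruleSurplus_nonneg (hrule : IsVCGRule (unitDemand I) rule)
    {v : N → Finset I → ℝ} (hv : ∀ i, v i ∈ unitDemand I) (ℓ : ℕ) :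
    0 ≤ ruleSurplus rule ℓ v :=
  Finset.sum_nonneg fun i _ =>
    sub_nonneg.2 ((hrule ℓ v hv).1.payment_le fun _ => (hv i).nonneg _)

/-- The scaled surpluses dominate a telescoping sum of scaled welfares. -/
theorem IsVCGRule.le_sum_ruleSurplus (hrule : IsVCGRule (unitDemand I) rule)
    {v : N → Finset I → ℝ} (hv : ∀ i, v i ∈ unitDemand I) (r : ℕ) :
    copiesWelfare 0 v - copiesWelfare r v / 2 ^ r ≤
      ∑ ℓ ∈ Finset.range (r + 1), ruleSurplus rule ℓ v / 2 ^ ℓ := by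
  induction r with
  | zero => simpa using hrule.ruleSurplus_nonneg hv 0
  | succ k ih =>
    rw [Finset.sum_range_succ]
    have h1 := sum_payment_le_copiesWelfare hv (hrule (k + 1) v hv).1
    -- Divided by 2^(k+1), the left side is the difference of consecutive scaled welfares, which
    -- telescopes.
    have h2 : 2 * copiesWelfare k v - copiesWelfare (k + 1) v ≤ ruleSurplus rule (k + 1) v := by
      rw [hrule.ruleSurplus_eq hv]
      simp only [rulePayment]
      linarith
    have h3 := div_le_div_of_nonneg_right h2 (c := 2 ^ (k + 1)) (by positivity)
    have h4 : 2 * copiesWelfare k v / 2 ^ (k + 1) = copiesWelfare k v / 2 ^ k := by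
      rw [pow_succ']
      exact mul_div_mul_left _ _ two_ne_zero
    rw [sub_div, h4] at h3
    linarith

/-- With at least `3 / 2 · |N|` copies in the last instance, the expected residual surplus is a
`3 (r + 1)`-approximation. -/
theorem IsVCGRule.le_expect_residualSurplus (hrule : IsVCGRule (unitDemand I) rule)
    {v : N → Finset I → ℝ} (hv : ∀ i, v i ∈ unitDemand I)
    (hr : 3 * Fintype.card N ≤ 2 ^ (r + 1)) :
    optWelfare v Finset.univ Finset.univ / (3 * (r + 1)) ≤
      expect (vcgWithCopies r rule unitDemandRounding v) (residualSurplus v) := by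
  rw [hrule.expect_residualSurplus hv, ← div_div]
  refine div_le_div_of_nonneg_right (le_trans ?_ (hrule.le_sum_ruleSurplus hv r)) (by positivity)
  have h0 := optWelfare_nonneg (fun i => (hv i).nonneg) Finset.univ Finset.univ
  have h1 := optWelfare_le_copiesWelfare_zero v
  have h2 := copiesWelfare_le_card_mul hv r
  have h3 : copiesWelfare r v / 2 ^ r ≤ 2 / 3 * optWelfare v Finset.univ Finset.univ := by
    rw [div_le_iff₀ (by positivity)]
    have h4 : (3 * Fintype.card N : ℝ) ≤ 2 ^ (r + 1) := by exact_mod_cast hr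
    rw [pow_succ] at h4
    have h5 := mul_le_mul_of_nonneg_right h4 h0
    linarith
  linarith

/-- For at most one agent there are no payments, and no copies are needed. -/
theorem IsVCGRule.optWelfare_le_expect_of_subsingleton [Subsingleton N]
    (hrule : IsVCGRule (unitDemand I) rule) {v : N → Finset I → ℝ}
    (hv : ∀ i, v i ∈ unitDemand I) :
    optWelfare v Finset.univ Finset.univ ≤
      expect (vcgWithCopies 0 rule unitDemandRounding v) (residualSurplus v) := by
  rw [hrule.expect_residualSurplus hv]
  simpa [hrule.ruleSurplus_eq hv, rulePayment, vcgPayment_of_subsingleton] using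
    optWelfare_le_copiesWelfare_zero v

end Copies

/-! ### Number of levels and the final constant -/

theorem three_mul_le_two_pow {n r : ℕ} (hn : 2 ≤ n)
    (hr : |(r : ℝ) - 2 * Real.logb 2 (n : ℝ)| < 1) : 3 * n ≤ 2 ^ (r + 1) := by
  have hn0 : (0 : ℝ) < n := by exact_mod_cast (by omega : 0 < n)
  have h1 : Real.logb 2 ((n : ℝ) ^ 2) < ((r + 1 : ℕ) : ℝ) := by
    rw [Real.logb_pow]
    push_cast
    linarith [(abs_lt.1 hr).1]
  rw [Real.logb_lt_iff_lt_rpow (by norm_num) (by positivity), Real.rpow_natCast] at h1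
  have h2 : n ^ 2 < 2 ^ (r + 1) := by exact_mod_cast h1
  -- For n ≥ 3, n² ≥ 3n suffices. For n = 2 it does not, but a power of 2 above 4 is at least 8 ≥ 6.
  rcases hn.eq_or_lt with rfl | hn3
  · have : 2 < r + 1 := (Nat.pow_lt_pow_iff_right (by norm_num)).1 h2
    have := Nat.pow_le_pow_right (n := 2) (by norm_num) this
    omega
  · nlinarith

end MoneyBurning

theorem mainTheorem1 :
    ∃ C : ℝ, 1 ≤ C ∧
      ∀ (n m r : ℕ), |(r : ℝ) - 2 * Real.logb 2 (n : ℝ)| < 1 →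
        ∀ rule : MoneyBurning.CopiesRule (Fin n) (Fin m),
          MoneyBurning.IsVCGRule (MoneyBurning.unitDemand (Fin m)) rule →
            MoneyBurning.IsFeasible (MoneyBurning.unitDemand (Fin m))
                (MoneyBurning.vcgWithCopies r rule MoneyBurning.unitDemandRounding) ∧
              MoneyBurning.TruthfulInExpectation (MoneyBurning.unitDemand (Fin m))
                (MoneyBurning.vcgWithCopies r rule MoneyBurning.unitDemandRounding) ∧
              MoneyBurning.ExPostIR (MoneyBurning.unitDemand (Fin m))
                (MoneyBurning.vcgWithCopies r rule MoneyBurning.unitDemandRounding) ∧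
              MoneyBurning.ApproximatesWelfare (MoneyBurning.unitDemand (Fin m))
                (MoneyBurning.vcgWithCopies r rule MoneyBurning.unitDemandRounding)
                (C * max 1 (Real.logb 2 (n : ℝ))) := by
  -- The constant is 12 because r + 1 < 2 log₂ n + 2 ≤ 4 max(1, log₂ n), and the approximation
  -- factor is 3(r + 1).
  refine ⟨12, by norm_num, fun n m r hr rule hrule =>
    ⟨hrule.isFeasible, hrule.truthfulInExpectation, hrule.exPostIR, fun v hv => ?_⟩⟩
  have h0 := MoneyBurning.optWelfare_nonneg (fun i => (hv i).nonneg) Finset.univ Finset.univ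
  have hmax : (1 : ℝ) ≤ max 1 (Real.logb 2 (n : ℝ)) := le_max_left _ _
  rcases Nat.lt_or_ge n 2 with hn | hn
  -- By the convention log 0 = 0, the case n = 0 also forces r = 0.
  · have hlog : Real.logb 2 (n : ℝ) = 0 := by interval_cases n <;> simp
    have hr0 : r = 0 := by
      rw [hlog, mul_zero, sub_zero, Nat.abs_cast] at hr
      have : r < 1 := by exact_mod_cast hr
      omega
    subst hr0
    have : Subsingleton (Fin n) := Fin.subsingleton_iff_le_one.2 (by omega)
    exact (div_le_self h0 (by linarith)).trans (hrule.optWelfare_le_expect_of_subsingleton hv)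
  · refine le_trans ?_ (hrule.le_expect_residualSurplus hv
      (by simpa using MoneyBurning.three_mul_le_two_pow hn hr))
    refine div_le_div_of_nonneg_left h0 (by positivity) ?_
    have := le_max_right 1 (Real.logb 2 (n : ℝ))
    linarith [(abs_lt.1 hr).2]
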